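/- Let $k$ be a commutative ring, let $H$ be a Hopf algebra over $k$ that is finitely generated and projective as a $k$-module, and let $A$ be a right $H$-comodule algebra, i.e. an associative unital $k$-algebra with a coassociative and counital coaction $A\to A\otimes_k H$, $a\mapsto a_{[0]}\otimes a_{[1]}$, that is a homomorphism of $k$-algebras. Let $H^*=\mathrm{Hom}_k(H,k)$ with the convolution product, and put $(f\leftharpoonup x)(y)=f(xy)$ and $(x\rightharpoonup f)(y)=f(yx)$ for $f\in H^*$, $x,y\in H$. Let $A\# H^*$ be the smash product, that is, $A\otimes_k H^*$ with the multiplication $$(a\# f)(b\# g)=a\,b_{[0]}\#(f\leftharpoonup b_{[1]})\,g ,$$ regarded as a left $H$-module algebra by $x\cdot(a\# f)=a\#(x\rightharpoonup f)$, and let $(A\# H^*)\# H$ be the smash product of this module algebra with $H$, that is, $(A\# H^*)\otimes_k H$ with the multiplication $$(r\# x)(s\# y)=r\,(x_{(1)}\cdot s)\#x_{(2)}\,y .$$ Regard $A\# H^*$ as a right $A$-module by right multiplication through the ring homomorphism $A\to A\# H^*$, $a\mapsto a\#\varepsilon$, where $\varepsilon$ is the counit of $H$. Then there is an isomorphism of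 rings $$(A\# H^*)\# H\;\cong\;\mathrm{End}\big((A\# H^*)_A\big),$$ where the right-hand side is the ring, under composition, of the right $A$-module endomorphisms of $A\# H^*$. -/

import Mathlib

open scoped TensorProduct

noncomputable section

/-! ### Comodule algebras and module algebras -/

/-- A right `H`-comodule algebra over `k`: a `k`-algebra `A` with a coassociative and counital
coaction `ρ : A → A ⊗ H`, `a ↦ a₀ ⊗ a₁`, that is a homomorphism of `k`-algebras. -/
class RightComoduleAlgebra (k H A : Type*) [CommRing k] [Ring H] [Bialgebra k H]
    [Ring A] [Algebra k A] where
  /-- The coaction. -/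
  coact : A →ₐ[k] A ⊗[k] H
  /-- `a₀₀ ⊗ (a₀₁ ⊗ a₁) = a₀ ⊗ (a₁₁ ⊗ a₁₂)`. -/
  coassoc : ∀ a : A,
    TensorProduct.assoc k A H H (coact.toLinearMap.rTensor H (coact a)) =
      (Coalgebra.comul (R := k) (A := H)).lTensor A (coact a)
  /-- `a₀ ε(a₁) = a`. -/
  counit_coact : ∀ a : A,
    TensorProduct.rid k A ((Coalgebra.counit (R := k) (A := H)).lTensor A (coact a)) = a

/-- For a left `H`-module `R`, the map `H ⊗ H → R`, `x ⊗ y ↦ (x • r) * (y • s)`. -/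
def smulMulSMul (k H : Type*) {R : Type*} [CommRing k] [Ring H] [Algebra k H]
    [Ring R] [Algebra k R] [Module H R] [IsScalarTower k H R] (r s : R) : H ⊗[k] H →ₗ[k] R :=
  LinearMap.mul' k R ∘ₗ TensorProduct.map
    ((LinearMap.toSpanSingleton H R r).restrictScalars k)
    ((LinearMap.toSpanSingleton H R s).restrictScalars k)

/-- A left `H`-module algebra over `k`: a `k`-algebra `R` that is a left `H`-module
(compatibly with `k`) such that `h • 1 = ε(h) 1` and `h • (r * s) = (h₁ • r) * (h₂ • s)`. -/
class LeftModuleAlgebra (k H R : Type*) [CommRing k] [Ring H] [Bialgebra k H]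
    [Ring R] [Algebra k R] [Module H R] [IsScalarTower k H R] : Prop where
  smul_one_eq : ∀ h : H, h • (1 : R) = algebraMap k R (Coalgebra.counit (R := k) h)
  smul_mul_eq : ∀ (h : H) (r s : R),
    h • (r * s) = smulMulSMul k H r s (Coalgebra.comul (R := k) h)

/-! ### The multiplication of `R ⊗ S` given by a twist map

Given a bilinear map `τ : S × R → R ⊗ S`, one puts `(r ⊗ s) (r' ⊗ s') = r τ(s, r') s'`.
Both smash products below are of this form. -/

section Twist

variable {k R S : Type*} [CommRing k] [Ring R] [Algebra k R] [Ring S] [Algebra k S]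

/-- The product `(r ⊗ s) (r' ⊗ s') = r τ(s, r') s'` on `R ⊗ S`. -/
def twistedMul (τ : S →ₗ[k] R →ₗ[k] R ⊗[k] S) :
    R ⊗[k] S →ₗ[k] R ⊗[k] S →ₗ[k] R ⊗[k] S :=
  TensorProduct.lift <| LinearMap.mk₂ k
    (fun r s => TensorProduct.lift <| LinearMap.mk₂ k
      (fun r' s' => TensorProduct.map (LinearMap.mulLeft k r) (LinearMap.mulRight k s') (τ s r'))
      (fun x y s' => by simp)
      (fun c x s' => by simp)
      (fun x s' t' => by
        have : LinearMap.mulRight k (s' + t') = LinearMap.mulRight k s' + LinearMap.mulRight k t' :=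
          by ext; simp [mul_add]
        rw [this, TensorProduct.map_add_right]; rfl)
      (fun c x s' => by
        have : LinearMap.mulRight k (c • s') = c • LinearMap.mulRight k s' := by ext; simp
        rw [this, TensorProduct.map_smul_right]; rfl))
    (fun r r' s => by
      have : LinearMap.mulLeft k (r + r') = LinearMap.mulLeft k r + LinearMap.mulLeft k r' :=
        by ext; simp [add_mul]
      ext; simp [this, TensorProduct.map_add_left])
    (fun c r s => by
      have : LinearMap.mulLeft k (c • r) = c • LinearMap.mulLeft k r := by ext; simp
      ext; simp [this, TensorProduct.map_smul_left])
    (fun r s s' => by ext; simp)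
    (fun c r s => by ext; simp)

theorem twistedMul_tmul (τ : S →ₗ[k] R →ₗ[k] R ⊗[k] S) (r : R) (s : S) (r' : R) (s' : S) :
    twistedMul τ (r ⊗ₜ[k] s) (r' ⊗ₜ[k] s') =
      TensorProduct.map (LinearMap.mulLeft k r) (LinearMap.mulRight k s') (τ s r') := rfl

theorem twistedMul_one_left (τ : S →ₗ[k] R →ₗ[k] R ⊗[k] S)
    (h : ∀ r, τ 1 r = r ⊗ₜ[k] 1) (x : R ⊗[k] S) :
    twistedMul τ (1 ⊗ₜ[k] 1) x = x := by
  induction x with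
  | zero => simp
  | add x y hx hy => rw [map_add, hx, hy]
  | tmul r s => simp [twistedMul_tmul, h]

theorem twistedMul_one_right (τ : S →ₗ[k] R →ₗ[k] R ⊗[k] S)
    (h : ∀ s, τ s 1 = 1 ⊗ₜ[k] s) (x : R ⊗[k] S) :
    twistedMul τ x (1 ⊗ₜ[k] 1) = x := by
  induction x with
  | zero => simp
  | add x y hx hy => rw [map_add, LinearMap.add_apply, hx, hy]
  | tmul r s => simp [twistedMul_tmul, h]

/-- Associativity of the twisted product, for a twist compatible with both multiplications:
`τ(s, r r') = r₍τ₎ τ(s₍τ₎, r')` and `τ(s s', r) = τ(s, r₍τ₎) s'₍τ₎`. -/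
theorem twistedMul_assoc (τ : S →ₗ[k] R →ₗ[k] R ⊗[k] S)
    (h₁ : ∀ s r r', τ s (r * r') = twistedMul τ (τ s r) (r' ⊗ₜ[k] 1))
    (h₂ : ∀ s s' r, τ (s * s') r = twistedMul τ (1 ⊗ₜ[k] s) (τ s' r))
    (x y z : R ⊗[k] S) :
    twistedMul τ (twistedMul τ x y) z = twistedMul τ x (twistedMul τ y z) := by
  have key : ∀ (r : R) (s' : S) (u v : R ⊗[k] S),
      TensorProduct.map (LinearMap.mulLeft k r) (LinearMap.mulRight k s') (twistedMul τ u v) =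
        twistedMul τ (TensorProduct.map (LinearMap.mulLeft k r) LinearMap.id u)
          (TensorProduct.map LinearMap.id (LinearMap.mulRight k s') v) := by
    intro r s' u v
    induction u with
    | zero => simp
    | add u u' hu hu' => simp only [map_add, LinearMap.add_apply, hu, hu']
    | tmul a f =>
      induction v with
      | zero => simp
      | add v v' hv hv' => simp only [map_add, hv, hv']
      | tmul b g =>
        simp only [twistedMul_tmul, TensorProduct.map_tmul, LinearMap.id_coe, id_eq,
          LinearMap.mulLeft_apply, LinearMap.mulRight_apply, LinearMap.mulLeft_mul,
          LinearMap.mulRight_mul, TensorProduct.map_comp, LinearMap.comp_apply]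
  -- the middle step: `(b₍τ₎ ⊗ f₍τ₎ g) (c ⊗ 1)`
  have mid : ∀ (u : R ⊗[k] S) (g : S) (c : R),
      twistedMul τ (TensorProduct.map LinearMap.id (LinearMap.mulRight k g) u) (c ⊗ₜ[k] 1) =
        twistedMul τ u (τ g c) := by
    intro u g c
    induction u with
    | zero => simp
    | add u u' hu hu' => simp only [map_add, LinearMap.add_apply, hu, hu']
    | tmul a f =>
      have e := key a 1 (1 ⊗ₜ[k] f) (τ g c)
      rw [← h₂] at e
      simpa [twistedMul_tmul, LinearMap.mulRight_one] using e
  have mid' : ∀ (f : S) (b : R) (v : R ⊗[k] S),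
      twistedMul τ (1 ⊗ₜ[k] f) (TensorProduct.map (LinearMap.mulLeft k b) LinearMap.id v) =
        twistedMul τ (τ f b) v := by
    intro f b v
    induction v with
    | zero => simp
    | add v v' hv hv' => simp only [map_add, hv, hv']
    | tmul c g =>
      have e := key 1 g (τ f b) (c ⊗ₜ[k] 1)
      rw [← h₁] at e
      simpa [twistedMul_tmul, LinearMap.mulLeft_one] using e
  induction x with
  | zero => simp
  | add x x' hx hx' => simp only [map_add, LinearMap.add_apply, hx, hx']
  | tmul a f =>
    induction y with
    | zero => simp
    | add y y' hy hy' => simp only [map_add, LinearMap.add_apply, hy, hy']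
    | tmul b g =>
      induction z with
      | zero => simp
      | add z z' hz hz' => simp only [map_add, hz, hz']
      | tmul c h =>
        have e1 : twistedMul τ (a ⊗ₜ[k] f) (b ⊗ₜ[k] g) =
            TensorProduct.map (LinearMap.mulLeft k a) LinearMap.id
              (TensorProduct.map LinearMap.id (LinearMap.mulRight k g) (τ f b)) := by
          rw [twistedMul_tmul, TensorProduct.map_map]; simp
        have e2 : twistedMul τ (b ⊗ₜ[k] g) (c ⊗ₜ[k] h) =
            TensorProduct.map LinearMap.id (LinearMap.mulRight k h)
              (TensorProduct.map (LinearMap.mulLeft k b) LinearMap.id (τ g c)) := by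
          rw [twistedMul_tmul, TensorProduct.map_map]; simp
        have e3 := key a h (TensorProduct.map LinearMap.id (LinearMap.mulRight k g) (τ f b))
          (c ⊗ₜ[k] 1)
        have e4 := key a h (1 ⊗ₜ[k] f)
          (TensorProduct.map (LinearMap.mulLeft k b) LinearMap.id (τ g c))
        rw [mid] at e3
        rw [mid'] at e4
        rw [e1, e2]
        simpa using e3.symm.trans e4

end Twist

/-! ### The smash product `A # H*` of a right comodule algebra -/

/-- The dual algebra `H* = Hom_k(H, k)`, with the convolution product
`(f * g)(x) = f(x₁) g(x₂)` and unit `ε`. -/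
def DualAlgebra (k H : Type*) [CommRing k] [Ring H] [Bialgebra k H] : Type _ :=
  WithConv (H →ₗ[k] k)

namespace DualAlgebra

variable {k H : Type*} [CommRing k] [Ring H] [Bialgebra k H]

instance : Ring (DualAlgebra k H) := inferInstanceAs (Ring (WithConv (H →ₗ[k] k)))

instance : Algebra k (DualAlgebra k H) := inferInstanceAs (Algebra k (WithConv (H →ₗ[k] k)))

/-- A linear form on `H`, as an element of `H*`. -/
def of (f : H →ₗ[k] k) : DualAlgebra k H := WithConv.toConv f

/-- The linear form on `H` underlying an element of `H*`. -/
def form (f : DualAlgebra k H) : H →ₗ[k] k := WithConv.ofConv f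

@[simp] theorem form_of (f : H →ₗ[k] k) : (of f).form = f := rfl

@[simp] theorem form_zero : (0 : DualAlgebra k H).form = 0 := rfl

@[simp] theorem form_add (f g : DualAlgebra k H) : (f + g).form = f.form + g.form := rfl

@[simp] theorem form_smul (c : k) (f : DualAlgebra k H) : (c • f).form = c • f.form := rfl

theorem form_one : (1 : DualAlgebra k H).form = Coalgebra.counit := rfl

theorem form_mul (f g : DualAlgebra k H) (x : H) :
    (f * g).form x =
      LinearMap.mul' k k (TensorProduct.map f.form g.form (Coalgebra.comul x)) := rfl

@[ext] theorem ext {f g : DualAlgebra k H} (h : ∀ x, f.form x = g.form x) : f = g :=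
  WithConv.ofConv_injective (LinearMap.ext h)

/-- The right action of `H` on `H*`: `(f ↼ x)(y) = f(x y)`. -/
def hitRight : DualAlgebra k H →ₗ[k] H →ₗ[k] DualAlgebra k H :=
  LinearMap.mk₂ k (fun f x => of (f.form ∘ₗ LinearMap.mulLeft k x))
    (fun f g x => by ext; simp) (fun c f x => by ext; simp)
    (fun f x y => by ext; simp [add_mul]) (fun c f x => by ext; simp)

@[simp] theorem hitRight_apply (f : DualAlgebra k H) (x y : H) :
    (hitRight f x).form y = f.form (x * y) := rfl

/-- The left action of `H` on `H*`: `(x ⇀ f)(y) = f(y x)`. -/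
def hitLeft : H →ₗ[k] DualAlgebra k H →ₗ[k] DualAlgebra k H :=
  LinearMap.mk₂ k (fun x f => of (f.form ∘ₗ LinearMap.mulRight k x))
    (fun f g x => by ext; simp [mul_add]) (fun c f x => by ext; simp)
    (fun f x y => by ext; simp) (fun c f x => by ext; simp)

@[simp] theorem hitLeft_apply (x : H) (f : DualAlgebra k H) (y : H) :
    (hitLeft x f).form y = f.form (y * x) := rfl

end DualAlgebra

/-- The underlying module `A ⊗ H*` of the smash product `A # H*` of a right `H`-comodule
algebra `A`. -/
def CoSmash (k H A : Type*) [CommRing k] [Ring H] [Bialgebra k H] [Ring A] [Algebra k A] :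
    Type _ :=
  A ⊗[k] DualAlgebra k H

namespace CoSmash

open DualAlgebra

variable {k H A : Type*} [CommRing k] [Ring H] [Bialgebra k H] [Ring A] [Algebra k A]

instance : AddCommGroup (CoSmash k H A) :=
  inferInstanceAs (AddCommGroup (A ⊗[k] DualAlgebra k H))

instance : Module k (CoSmash k H A) :=
  inferInstanceAs (Module k (A ⊗[k] DualAlgebra k H))

/-- The element `a # f`. -/
def mk (a : A) (f : DualAlgebra k H) : CoSmash k H A := a ⊗ₜ[k] f

variable [RightComoduleAlgebra k H A]

/-- The twist `H* × A → A ⊗ H*`, `(f, b) ↦ b₀ ⊗ (f ↼ b₁)`. -/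
def twist : DualAlgebra k H →ₗ[k] A →ₗ[k] A ⊗[k] DualAlgebra k H :=
  LinearMap.mk₂ k (fun f b => (hitRight f).lTensor A (RightComoduleAlgebra.coact (k := k) b))
    (fun f g b => by simp) (fun c f b => by simp [LinearMap.lTensor_smul])
    (fun f b c => by simp) (fun c f b => by simp)

theorem twist_apply (f : DualAlgebra k H) (b : A) :
    twist f b = (hitRight f).lTensor A (RightComoduleAlgebra.coact (k := k) b) := rfl

theorem twist_mul_right (f : DualAlgebra k H) (b c : A) :
    twist f (b * c) = twistedMul twist (twist f b) (c ⊗ₜ[k] 1) := by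
  have aux : ∀ u : A ⊗[k] H, (hitRight f).lTensor A (u * RightComoduleAlgebra.coact (k := k) c) =
      twistedMul twist ((hitRight f).lTensor A u) (c ⊗ₜ[k] 1) := by
    intro u
    induction u with
    | zero => simp
    | add u u' hu hu' => simp only [add_mul, map_add, LinearMap.add_apply, hu, hu']
    | tmul a x =>
      rw [LinearMap.lTensor_tmul, twistedMul_tmul, twist_apply]
      generalize RightComoduleAlgebra.coact (k := k) (H := H) c = v
      induction v with
      | zero => simp
      | add v v' hv hv' => simp only [mul_add, map_add, hv, hv']
      | tmul d y =>
        simp only [Algebra.TensorProduct.tmul_mul_tmul, LinearMap.lTensor_tmul,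
          TensorProduct.map_tmul, LinearMap.mulLeft_apply, LinearMap.mulRight_apply, mul_one]
        congr 1
        ext z
        simp [mul_assoc]
  rw [twist_apply, map_mul, aux, twist_apply]

theorem hitRight_mul (f g : DualAlgebra k H) :
    hitRight (f * g) = LinearMap.mul' k (DualAlgebra k H) ∘ₗ
      TensorProduct.map (hitRight f) (hitRight g) ∘ₗ Coalgebra.comul := by
  have aux : ∀ (y : H) (u : H ⊗[k] H),
      LinearMap.mul' k k (TensorProduct.map f.form g.form
        (u * Coalgebra.comul (R := k) y)) =
      (LinearMap.mul' k (DualAlgebra k H)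
        (TensorProduct.map (hitRight f) (hitRight g) u)).form y := by
    intro y u
    induction u with
    | zero => simp
    | add u u' hu hu' =>
      simp only [add_mul, map_add, hu, hu', form_add, LinearMap.add_apply]
    | tmul a b =>
      simp only [TensorProduct.map_tmul, LinearMap.mul'_apply, form_mul]
      generalize Coalgebra.comul (R := k) y = v
      induction v with
      | zero => simp
      | add v v' hv hv' => simp only [mul_add, map_add, hv, hv']
      | tmul c d => simp
  ext x y
  simp only [hitRight_apply, form_mul, Bialgebra.comul_mul, LinearMap.comp_apply,
    aux]

theorem twist_mul_left (f g : DualAlgebra k H) (b : A) :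
    twist (f * g) b = twistedMul twist (1 ⊗ₜ[k] f) (twist g b) := by
  have aux : ∀ u : A ⊗[k] H, twistedMul twist (1 ⊗ₜ[k] f) ((hitRight g).lTensor A u) =
      (LinearMap.mul' k (DualAlgebra k H) ∘ₗ
        TensorProduct.map (hitRight f) (hitRight g)).lTensor A
        (TensorProduct.assoc k A H H
          ((RightComoduleAlgebra.coact (k := k) (H := H) (A := A)).toLinearMap.rTensor H u)) := by
    intro u
    induction u with
    | zero => simp
    | add u u' hu hu' => simp only [map_add, hu, hu']
    | tmul a x =>
      simp only [LinearMap.lTensor_tmul, twistedMul_tmul, twist_apply, LinearMap.rTensor_tmul,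
        AlgHom.toLinearMap_apply]
      generalize RightComoduleAlgebra.coact (k := k) (H := H) a = v
      induction v with
      | zero => simp
      | add v v' hv hv' => simp only [TensorProduct.add_tmul, map_add, hv, hv']
      | tmul d y => simp
  rw [twist_apply g, aux, RightComoduleAlgebra.coassoc, twist_apply, hitRight_mul,
    ← LinearMap.comp_apply, ← LinearMap.lTensor_comp]
  rfl

theorem twist_one_left (b : A) :
    twist (1 : DualAlgebra k H) b = b ⊗ₜ[k] (1 : DualAlgebra k H) := by
  have aux : ∀ u : A ⊗[k] H, (hitRight (1 : DualAlgebra k H)).lTensor A u =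
      TensorProduct.rid k A ((Coalgebra.counit (R := k) (A := H)).lTensor A u) ⊗ₜ[k]
        (1 : DualAlgebra k H) := by
    intro u
    induction u with
    | zero => simp
    | add u u' hu hu' => simp only [map_add, TensorProduct.add_tmul, hu, hu']
    | tmul a x =>
      have : hitRight (1 : DualAlgebra k H) x =
          Coalgebra.counit (R := k) x • (1 : DualAlgebra k H) := by
        ext y; simp [form_one]
      simp [this, TensorProduct.smul_tmul]
  rw [twist_apply, aux, RightComoduleAlgebra.counit_coact]

theorem twist_one_right (f : DualAlgebra k H) :
    twist f (1 : A) = (1 : A) ⊗ₜ[k] f := by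
  have : hitRight f (1 : H) = f := by ext; simp
  rw [twist_apply, map_one, Algebra.TensorProduct.one_def, LinearMap.lTensor_tmul, this]

/-- `(a # f) (b # g) = a b₀ # (f ↼ b₁) g`. -/
instance : Mul (CoSmash k H A) where
  mul x y := twistedMul (R := A) (S := DualAlgebra k H) twist x y

instance : One (CoSmash k H A) where
  one := mk 1 1

theorem mul_def (x y : CoSmash k H A) :
    x * y = twistedMul (R := A) (S := DualAlgebra k H) twist x y := rfl

/-- The product of `a # f` and `b # g` in Sweedler form, for an expansion
`b₀ ⊗ b₁ = ∑ i, p i ⊗ q i` of the coaction. -/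
theorem mk_mul_mk {ι : Type*} (s : Finset ι) (p : ι → A) (q : ι → H)
    (a b : A) (f g : DualAlgebra k H)
    (hb : RightComoduleAlgebra.coact (k := k) b = ∑ i ∈ s, p i ⊗ₜ[k] q i) :
    mk a f * mk b g = ∑ i ∈ s, mk (a * p i) (hitRight f (q i) * g) := by
  have : twistedMul twist (a ⊗ₜ[k] f) (b ⊗ₜ[k] g) =
      ∑ i ∈ s, (a * p i) ⊗ₜ[k] (hitRight f (q i) * g) := by
    simp only [twistedMul_tmul, twist_apply, hb, map_sum, LinearMap.lTensor_tmul,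
      TensorProduct.map_tmul, LinearMap.mulLeft_apply, LinearMap.mulRight_apply]
  exact this

instance : Ring (CoSmash k H A) where
  __ := (inferInstance : AddCommGroup (CoSmash k H A))
  left_distrib x y z := map_add (twistedMul (R := A) (S := DualAlgebra k H) twist x) y z
  right_distrib x y z := LinearMap.map_add₂ (twistedMul (R := A) (S := DualAlgebra k H) twist) x y z
  zero_mul x := LinearMap.map_zero₂ (twistedMul (R := A) (S := DualAlgebra k H) twist) x
  mul_zero x := map_zero (twistedMul (R := A) (S := DualAlgebra k H) twist x)
  mul_assoc := twistedMul_assoc twist twist_mul_right twist_mul_left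
  one_mul := twistedMul_one_left twist twist_one_left
  mul_one := twistedMul_one_right twist twist_one_right

instance : Algebra k (CoSmash k H A) :=
  Algebra.ofModule
    (fun c x y => LinearMap.map_smul₂ (twistedMul (R := A) (S := DualAlgebra k H) twist) c x y)
    (fun c x y => map_smul (twistedMul (R := A) (S := DualAlgebra k H) twist x) c y)

/-- The embedding `A → A # H*`, `a ↦ a # ε`. -/
def incl (k H A : Type*) [CommRing k] [Ring H] [Bialgebra k H] [Ring A] [Algebra k A]
    [RightComoduleAlgebra k H A] : A →+* CoSmash k H A where
  toFun a := mk a 1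
  map_one' := rfl
  map_zero' := TensorProduct.zero_tmul _ _
  map_add' a b := TensorProduct.add_tmul _ _ _
  map_mul' a b := by
    have : (a * b) ⊗ₜ[k] (1 : DualAlgebra k H) =
        twistedMul twist (a ⊗ₜ[k] (1 : DualAlgebra k H)) (b ⊗ₜ[k] 1) := by
      rw [twistedMul_tmul, twist_one_left]; simp
    exact this

/-- `A # H*` as a right `A`-module, by right multiplication through `a ↦ a # ε`. -/
instance : Module Aᵐᵒᵖ (CoSmash k H A) :=
  Module.compHom (CoSmash k H A) (incl k H A).op

theorem op_smul_eq (a : A) (x : CoSmash k H A) : MulOpposite.op a • x = x * mk a 1 := rfl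

/-- The left action of `H` on `A # H*`: `x • (a # f) = a # (x ⇀ f)`. -/
instance : Module H (CoSmash k H A) where
  smul x z := (hitLeft (k := k) x).lTensor A z
  one_smul z := by
    have : hitLeft (k := k) (1 : H) = LinearMap.id := by ext f y; simp
    change (hitLeft (k := k) (1 : H)).lTensor A z = z
    rw [this, LinearMap.lTensor_id]; rfl
  mul_smul x y z := by
    have : hitLeft (k := k) (x * y) = hitLeft x ∘ₗ hitLeft y := by ext f z; simp [mul_assoc]
    change (hitLeft (k := k) (x * y)).lTensor A z = _
    rw [this, LinearMap.lTensor_comp]; rfl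
  smul_zero x := map_zero ((hitLeft (k := k) x).lTensor A)
  smul_add x := map_add ((hitLeft (k := k) x).lTensor A)
  add_smul x y z := by
    change (hitLeft (k := k) (x + y)).lTensor A z = _
    rw [map_add, LinearMap.lTensor_add]; rfl
  zero_smul z := by
    change (hitLeft (k := k) (0 : H)).lTensor A z = _
    rw [map_zero, LinearMap.lTensor_zero]; rfl

theorem smul_mk (x : H) (a : A) (f : DualAlgebra k H) : x • mk a f = mk a (hitLeft x f) := rfl

instance : IsScalarTower k H (CoSmash k H A) where
  smul_assoc c x z := by
    change (hitLeft (k := k) (c • x)).lTensor A z = c • (hitLeft (k := k) x).lTensor A z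
    rw [map_smul, LinearMap.lTensor_smul]; rfl

theorem hitLeft_mul (x : H) (f g : DualAlgebra k H) :
    hitLeft x (f * g) = LinearMap.mul' k (DualAlgebra k H)
      (TensorProduct.map ((hitLeft (k := k)).flip f) ((hitLeft (k := k)).flip g)
        (Coalgebra.comul x)) := by
  have aux : ∀ (y : H) (u : H ⊗[k] H),
      LinearMap.mul' k k (TensorProduct.map f.form g.form (Coalgebra.comul (R := k) y * u)) =
      (LinearMap.mul' k (DualAlgebra k H)
        (TensorProduct.map ((hitLeft (k := k)).flip f) ((hitLeft (k := k)).flip g) u)).form y := by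
    intro y u
    induction u with
    | zero => simp
    | add u u' hu hu' =>
      simp only [mul_add, map_add, hu, hu', form_add, LinearMap.add_apply]
    | tmul a b =>
      simp only [TensorProduct.map_tmul, LinearMap.mul'_apply, form_mul]
      generalize Coalgebra.comul (R := k) y = v
      induction v with
      | zero => simp
      | add v v' hv hv' => simp only [add_mul, map_add, hv, hv']
      | tmul c d => simp
  ext y
  simp only [hitLeft_apply, form_mul, Bialgebra.comul_mul, aux]

instance : LeftModuleAlgebra k H (CoSmash k H A) where
  smul_one_eq x := by
    have : hitLeft x (1 : DualAlgebra k H) =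
        Coalgebra.counit (R := k) x • (1 : DualAlgebra k H) := by
      ext y; simp [form_one, mul_comm]
    rw [Algebra.algebraMap_eq_smul_one]
    change mk 1 (hitLeft x (1 : DualAlgebra k H)) = _
    rw [this]
    exact TensorProduct.tmul_smul _ _ _
  smul_mul_eq x z w := by
    have hlin : ∀ u : H ⊗[k] H, ∀ z z' w : CoSmash k H A,
        smulMulSMul k H (z + z') w u = smulMulSMul k H z w u + smulMulSMul k H z' w u := by
      intro u z z' w
      induction u with
      | zero => simp
      | add u u' hu hu' => simp only [map_add, hu, hu']; abel
      | tmul a b => simp [smulMulSMul, add_mul]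
    have hlin' : ∀ u : H ⊗[k] H, ∀ z w w' : CoSmash k H A,
        smulMulSMul k H z (w + w') u = smulMulSMul k H z w u + smulMulSMul k H z w' u := by
      intro u z w w'
      induction u with
      | zero => simp
      | add u u' hu hu' => simp only [map_add, hu, hu']; abel
      | tmul a b => simp [smulMulSMul, mul_add]
    have hz : ∀ u : H ⊗[k] H, ∀ w : CoSmash k H A, smulMulSMul k H 0 w u = 0 := by
      intro u w; simpa using hlin u 0 0 w
    have hz' : ∀ u : H ⊗[k] H, ∀ z : CoSmash k H A, smulMulSMul k H z 0 u = 0 := by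
      intro u z; simpa using hlin' u z 0 0
    induction z using TensorProduct.induction_on with
    | zero => exact (congrArg (x • ·) (zero_mul w)).trans ((smul_zero x).trans (hz _ _).symm)
    | add z z' h h' =>
      exact (congrArg (x • ·) (add_mul (R := CoSmash k H A) z z' w)).trans
        ((smul_add x _ _).trans ((congrArg₂ (· + ·) h h').trans (hlin _ _ _ _).symm))
    | tmul a f =>
      induction w using TensorProduct.induction_on with
      | zero =>
        exact (congrArg (x • ·) (mul_zero (M₀ := CoSmash k H A) _)).trans
          ((smul_zero x).trans (hz' _ _).symm)
      | add w w' h h' =>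
        exact (congrArg (x • ·) (mul_add (R := CoSmash k H A) _ w w')).trans
          ((smul_add x _ _).trans ((congrArg₂ (· + ·) h h').trans (hlin' _ _ _ _).symm))
      | tmul b g =>
        change x • (mk a f * mk b g) = smulMulSMul k H (mk a f) (mk b g) _
        obtain ⟨n, p, q, hb⟩ :=
          TensorProduct.exists_sum_tmul_eq (RightComoduleAlgebra.coact (k := k) (H := H) b)
        have key : ∀ u : H ⊗[k] H, smulMulSMul k H (mk a f) (mk b g) u =
            ∑ i, mk (a * p i) (LinearMap.mul' k (DualAlgebra k H)
              (TensorProduct.map ((hitLeft (k := k)).flip (hitRight f (q i)))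
                ((hitLeft (k := k)).flip g) u)) := by
          intro u
          induction u with
          | zero =>
            simp only [map_zero]
            exact (Finset.sum_eq_zero fun i _ => TensorProduct.tmul_zero _ _).symm
          | add u u' hu hu' =>
            rw [map_add, hu, hu', ← Finset.sum_add_distrib]
            refine Finset.sum_congr rfl fun i _ => ?_
            rw [map_add, map_add]
            exact (TensorProduct.tmul_add _ _ _).symm
          | tmul c d =>
            have e : smulMulSMul k H (mk a f) (mk b g) (c ⊗ₜ[k] d) =
              mk a (hitLeft c f) * mk b (hitLeft d g) := rfl
            rw [e, mk_mul_mk _ p q _ _ _ _ hb]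
            refine Finset.sum_congr rfl fun i _ => ?_
            congr 2
            ext y
            simp [mul_assoc]
        rw [key, mk_mul_mk _ p q _ _ _ _ hb, Finset.smul_sum]
        refine Finset.sum_congr rfl fun i _ => ?_
        rw [smul_mk, hitLeft_mul]

end CoSmash

/-! ### The smash product `R # H` of a left module algebra -/

/-- The underlying module `R ⊗ H` of the smash product `R # H` of a left `H`-module
algebra `R`. -/
def Smash (k H R : Type*) [CommRing k] [Ring H] [Bialgebra k H] [Ring R] [Algebra k R] :
    Type _ :=
  R ⊗[k] H

namespace Smash

variable {k H R : Type*} [CommRing k] [Ring H] [Bialgebra k H] [Ring R] [Algebra k R]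

instance : AddCommGroup (Smash k H R) := inferInstanceAs (AddCommGroup (R ⊗[k] H))

instance : Module k (Smash k H R) := inferInstanceAs (Module k (R ⊗[k] H))

/-- The element `r # x`. -/
def mk (r : R) (x : H) : Smash k H R := r ⊗ₜ[k] x

variable [Module H R] [IsScalarTower k H R]

/-- The twist `H × R → R ⊗ H`, `(x, r) ↦ (x₁ • r) ⊗ x₂`. -/
def twist : H →ₗ[k] R →ₗ[k] R ⊗[k] H :=
  LinearMap.mk₂ k (fun x r => ((LinearMap.toSpanSingleton H R r).restrictScalars k).rTensor H
      (Coalgebra.comul (R := k) x))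
    (fun x y r => by simp) (fun c x r => by simp)
    (fun x r s => by
      have : (LinearMap.toSpanSingleton H R (r + s)).restrictScalars k =
          (LinearMap.toSpanSingleton H R r).restrictScalars k +
            (LinearMap.toSpanSingleton H R s).restrictScalars k := by ext; simp
      rw [this, LinearMap.rTensor_add]; rfl)
    (fun c x r => by
      have : (LinearMap.toSpanSingleton H R (c • r)).restrictScalars k =
          c • (LinearMap.toSpanSingleton H R r).restrictScalars k := by
        ext y; simp [smul_algebra_smul_comm]
      rw [this, LinearMap.rTensor_smul]; rfl)

theorem twist_apply (x : H) (r : R) :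
    twist x r = ((LinearMap.toSpanSingleton H R r).restrictScalars k).rTensor H
      (Coalgebra.comul (R := k) x) := rfl

theorem twist_mul_left (x y : H) (r : R) :
    twist (k := k) (x * y) r = twistedMul twist (1 ⊗ₜ[k] x) (twist y r) := by
  have aux : ∀ u : H ⊗[k] H,
      ((LinearMap.toSpanSingleton H R r).restrictScalars k).rTensor H
        (Coalgebra.comul (R := k) x * u) =
      twistedMul twist (1 ⊗ₜ[k] x)
        (((LinearMap.toSpanSingleton H R r).restrictScalars k).rTensor H u) := by
    intro u
    induction u with
    | zero => simp
    | add u u' hu hu' => simp only [mul_add, map_add, hu, hu']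
    | tmul a b =>
      simp only [LinearMap.rTensor_tmul, twistedMul_tmul, twist_apply]
      generalize Coalgebra.comul (R := k) x = v
      induction v with
      | zero => simp
      | add v v' hv hv' => simp only [add_mul, map_add, hv, hv']
      | tmul c d => simp [mul_smul]
  rw [twist_apply, Bialgebra.comul_mul, aux, twist_apply]

theorem twist_one_left (r : R) : twist (k := k) (1 : H) r = r ⊗ₜ[k] (1 : H) := by
  simp [twist_apply, Bialgebra.comul_one, Algebra.TensorProduct.one_def]

/-- `(r # x) (s # y) = r (x₁ • s) # x₂ y`. -/
instance : Mul (Smash k H R) where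
  mul u v := twistedMul (R := R) (S := H) twist u v

instance : One (Smash k H R) where
  one := mk 1 1

/-- The product of `r # x` and `s # y` in Sweedler form, for an expansion
`x₁ ⊗ x₂ = ∑ i, p i ⊗ q i` of the comultiplication. -/
theorem mk_mul_mk {ι : Type*} (t : Finset ι) (p q : ι → H) (r s : R) (x y : H)
    (hx : Coalgebra.comul (R := k) x = ∑ i ∈ t, p i ⊗ₜ[k] q i) :
    (mk r x * mk s y : Smash k H R) = ∑ i ∈ t, mk (r * p i • s) (q i * y) := by
  have : twistedMul twist (r ⊗ₜ[k] x) (s ⊗ₜ[k] y) =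
      ∑ i ∈ t, (r * p i • s) ⊗ₜ[k] (q i * y) := by
    simp [twistedMul_tmul, twist_apply, hx, map_sum]
  exact this

variable [LeftModuleAlgebra k H R]

theorem twist_mul_right (x : H) (r s : R) :
    twist (k := k) x (r * s) = twistedMul twist (twist x r) (s ⊗ₜ[k] 1) := by
  have aux : ∀ u : H ⊗[k] H,
      twistedMul twist (((LinearMap.toSpanSingleton H R r).restrictScalars k).rTensor H u)
        (s ⊗ₜ[k] 1) =
      (smulMulSMul k H r s).rTensor H ((TensorProduct.assoc k H H H).symm
        ((Coalgebra.comul (R := k) (A := H)).lTensor H u)) := by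
    intro u
    induction u with
    | zero => simp
    | add u u' hu hu' => simp only [map_add, LinearMap.add_apply, hu, hu']
    | tmul a b =>
      simp only [LinearMap.rTensor_tmul, LinearMap.lTensor_tmul, twistedMul_tmul, twist_apply]
      generalize Coalgebra.comul (R := k) b = v
      induction v with
      | zero => simp
      | add v v' hv hv' => simp only [TensorProduct.tmul_add, map_add, hv, hv']
      | tmul c d => simp [smulMulSMul]
  have e : ((LinearMap.toSpanSingleton H R (r * s)).restrictScalars k) =
      smulMulSMul k H r s ∘ₗ Coalgebra.comul (R := k) := by
    ext x; simp [LeftModuleAlgebra.smul_mul_eq (k := k)]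
  rw [twist_apply x r, aux, Coalgebra.coassoc_symm_apply, twist_apply, e,
    LinearMap.rTensor_comp, LinearMap.comp_apply]

theorem twist_one_right (x : H) : twist (k := k) x (1 : R) = (1 : R) ⊗ₜ[k] x := by
  have e : ((LinearMap.toSpanSingleton H R 1).restrictScalars k) =
      Algebra.linearMap k R ∘ₗ Coalgebra.counit (R := k) := by
    ext x; simp [LeftModuleAlgebra.smul_one_eq (k := k)]
  rw [twist_apply, e, LinearMap.rTensor_comp, LinearMap.comp_apply,
    Coalgebra.rTensor_counit_comul]
  simp

instance : Ring (Smash k H R) where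
  __ := (inferInstance : AddCommGroup (Smash k H R))
  left_distrib x y z := map_add (twistedMul (R := R) (S := H) twist x) y z
  right_distrib x y z := LinearMap.map_add₂ (twistedMul (R := R) (S := H) twist) x y z
  zero_mul x := LinearMap.map_zero₂ (twistedMul (R := R) (S := H) twist) x
  mul_zero x := map_zero (twistedMul (R := R) (S := H) twist x)
  mul_assoc := twistedMul_assoc twist twist_mul_right twist_mul_left
  one_mul := twistedMul_one_left twist twist_one_left
  mul_one := twistedMul_one_right twist twist_one_right

end Smash

end

/-! The ring `(A # H*) # H` acts on `A # H*` by `(r # x) z = r (x • z)`. This is multiplicative by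
the module algebra axiom, and it commutes with right multiplication by `A` because `x • (a # ε) =
ε(x) (a # ε)`. The action map is inverted explicitly: for a dual basis `(e, c)` of `H` and `T` the
inverse of the antipode `S`, send `φ` to `∑ i j, φ(1 # c j) (1 # c i) # T(e i) e j`. Both composites
collapse by `T(x₂) x₁ = ε(x) = x₂ T(x₁)` (`actInv_actLinear`, `actLinear_actInv_inr`). On
endomorphisms it suffices to test the elements `1 # f`, which generate `A # H*` over `A`, again
thanks to `T` (`span_range_inr`).

Everything thus rests on `S` being bijective. This is proved inside `End_k(H*)`, where `X x` is the
action `x ⇀ ·` and `L g` is left multiplication. The operator `P = ∑ i, X(S² e i) L(c i)` projects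
`H*` onto its integrals, and satisfies `P L(g) X(S x) P = g(x) P` and `∑ i, X(S e i) P L(c i) = 1`.
These identities play the role of the structure theorem for the Hopf module `H*`, and require no
generator of the integrals. They recover `x` linearly from `S x`, which gives a left inverse of `S`.
A left inverse is a surjective endomorphism of a finitely generated module, hence injective, so `S`
is bijective. -/

noncomputable section

open Coalgebra HopfAlgebra

/-! ### Dual bases and the canonical element `∑ i, c i ⊗ e i`. -/

section FiniteDualBasis

variable {k H ι : Type*} [CommRing k] [Ring H] [Bialgebra k H] [Fintype ι]

/-- Finite families `e` in `H` and `c` in `H*` with `x = ∑ i, c i x • e i` for all `x`. -/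
def IsDualBasis (e : ι → H) (c : ι → DualAlgebra k H) : Prop :=
  ∀ x, ∑ i, (c i).form x • e i = x

theorem exists_isDualBasis (k H : Type*) [CommRing k] [Ring H] [Bialgebra k H]
    [Module.Finite k H] [Module.Projective k H] :
    ∃ (n : ℕ) (e : Fin n → H) (c : Fin n → DualAlgebra k H), IsDualBasis e c := by
  obtain ⟨n, f, g, -, -, h⟩ := Module.Finite.exists_comp_eq_id_of_projective k H
  refine ⟨n, fun i => f (Pi.single i 1), fun i => .of (LinearMap.proj i ∘ₗ g), fun x => ?_⟩
  conv_rhs => rw [← LinearMap.id_apply (R := k) x, ← h, LinearMap.comp_apply,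
    LinearMap.pi_apply_eq_sum_univ f (g x)]
  refine Finset.sum_congr rfl fun i _ => ?_
  simp only [DualAlgebra.form_of, LinearMap.comp_apply, LinearMap.proj_apply]
  congr 2
  ext j
  simp [Pi.single_apply, eq_comm]

namespace DualAlgebra

theorem form_sum {κ : Type*} (s : Finset κ) (f : κ → DualAlgebra k H) (x : H) :
    (∑ i ∈ s, f i).form x = ∑ i ∈ s, (f i).form x := by
  classical
  induction s using Finset.induction_on with
  | empty => simp
  | insert i s hi ih => simp [Finset.sum_insert hi, ih]

theorem form_mul_repr (f g : DualAlgebra k H) {x : H} {κ : Type*} (r : Coalgebra.Repr k x κ) :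
    (f * g).form x = ∑ j ∈ r.index, f.form (r.left j) * g.form (r.right j) := by
  rw [form_mul, ← r.eq]; simp [map_sum]

end DualAlgebra

open DualAlgebra

namespace IsDualBasis

variable {e : ι → H} {c : ι → DualAlgebra k H} {M : Type*} [AddCommGroup M] [Module k M]

theorem sum_apply_smul (h : IsDualBasis e c) (g : H →ₗ[k] k) : ∑ i, g (e i) • c i = of g := by
  ext x
  conv_rhs => rw [← h x]
  simp [form_sum, mul_comm]

theorem sum_map (h : IsDualBasis e c) (g : H →ₗ[k] M) (x : H) :
    ∑ i, (c i).form x • g (e i) = g x := by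
  conv_rhs => rw [← h x]
  simp

/-- A linear endomorphism may be moved across the canonical element `∑ i, c i ⊗ e i`. -/
theorem sum_apply_map (h : IsDualBasis e c) (B : DualAlgebra k H →ₗ[k] H →ₗ[k] M)
    (φ : H →ₗ[k] H) :
    ∑ i, B (of ((c i).form ∘ₗ φ)) (e i) = ∑ i, B (c i) (φ (e i)) := by
  have e1 : ∀ i, B (of ((c i).form ∘ₗ φ)) (e i) =
      ∑ j, (c i).form (φ (e j)) • B (c j) (e i) := fun i => by
    rw [← h.sum_apply_smul]; simp [map_sum]
  simp only [e1]
  rw [Finset.sum_comm]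
  exact Finset.sum_congr rfl fun j _ => h.sum_map (B (c j)) (φ (e j))

/-- `∑ i, c i ⊗ Δ(e i) = ∑ i j, c i * c j ⊗ (e i ⊗ e j)`. -/
theorem sum_apply_comul (h : IsDualBasis e c)
    (B : DualAlgebra k H →ₗ[k] H ⊗[k] H →ₗ[k] M) :
    ∑ i, B (c i) (comul (R := k) (e i)) = ∑ i, ∑ j, B (c i * c j) (e i ⊗ₜ[k] e j) := by
  -- The products `e i ⊗ e j`, with coordinate forms `c i ⊗ c j`, are a dual basis of `H ⊗ H`; on
  -- `Δ(x)` these coordinates are the convolutions `(c i * c j)(x)`.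
  have key : ∀ u : H ⊗[k] H, u = ∑ i, ∑ j,
      LinearMap.mul' k k (TensorProduct.map (c i).form (c j).form u) • (e i ⊗ₜ[k] e j) := by
    intro u
    induction u with
    | zero => simp
    | add u u' hu hu' =>
      conv_lhs => rw [hu, hu']
      simp only [map_add, add_smul, Finset.sum_add_distrib]
    | tmul x y =>
      conv_lhs => rw [← h x, ← h y]
      simp only [TensorProduct.sum_tmul, TensorProduct.tmul_sum, TensorProduct.smul_tmul_smul,
        TensorProduct.map_tmul, LinearMap.mul'_apply]
      exact Finset.sum_comm
  have e1 : ∀ l, B (c l) (comul (R := k) (e l)) =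
      ∑ i, ∑ j, (c i * c j).form (e l) • B (c l) (e i ⊗ₜ[k] e j) := fun l => by
    conv_lhs => rw [key (comul (e l))]
    simp [map_sum, form_mul]
  simp only [e1]
  rw [Finset.sum_comm]
  refine Finset.sum_congr rfl fun i _ => ?_
  rw [Finset.sum_comm]
  refine Finset.sum_congr rfl fun j _ => ?_
  have := h.sum_apply_smul (c i * c j).form
  change _ = c i * c j at this
  conv_rhs => rw [← this]
  simp [map_sum]

theorem sum_counit_smul (h : IsDualBasis e c) : ∑ i, counit (R := k) (e i) • c i = 1 :=
  h.sum_apply_smul counit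

end IsDualBasis

end FiniteDualBasis

/-! ### The antipode and the comultiplication. -/

section Antipode

variable {k H : Type*} [CommRing k] [Ring H] [HopfAlgebra k H]

open WithConv in
/-- The antipode is an anti-homomorphism of coalgebras. -/
theorem comul_antipode_eq (x : H) :
    comul (R := k) (antipode k x) = TensorProduct.map (antipode k) (antipode k)
      (TensorProduct.comm k H H (comul (R := k) x)) := by
  let i₁ : H →ₐ[k] H ⊗[k] H := Algebra.TensorProduct.includeLeft
  let i₂ : H →ₐ[k] H ⊗[k] H := Algebra.TensorProduct.includeRight
  have inv : ∀ i : H →ₐ[k] H ⊗[k] H,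
      toConv i.toLinearMap * toConv (i.toLinearMap ∘ₗ antipode k) = 1 ∧
      toConv (i.toLinearMap ∘ₗ antipode k) * toConv i.toLinearMap = 1 := by
    intro i
    have h1 := LinearMap.algHom_comp_convMul_distrib i (toConv LinearMap.id) (toConv (antipode k))
    have h2 := LinearMap.algHom_comp_convMul_distrib i (toConv (antipode k)) (toConv LinearMap.id)
    rw [LinearMap.id_mul_antipode] at h1
    rw [LinearMap.antipode_mul_id] at h2
    have h0 : i.toLinearMap ∘ₗ (1 : WithConv (H →ₗ[k] H)).ofConv =
        (1 : WithConv (H →ₗ[k] H ⊗[k] H)).ofConv := by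
      ext x; simp [LinearMap.convOne_def]
    rw [h0] at h1 h2
    exact ⟨(WithConv.ofConv_injective h1).symm, (WithConv.ofConv_injective h2).symm⟩
  -- `Δ` is the convolution product of the two inclusions, so the reversed product of their inverses
  -- `i₂ S` and `i₁ S` is a left inverse of `Δ`. It must equal the right inverse `Δ S`.
  have hδ : toConv (comul (R := k) (A := H)) = toConv i₁.toLinearMap * toConv i₂.toLinearMap := by
    ext x
    rw [(ℛ k x).convMul_apply]
    simp [i₁, i₂, (ℛ k x).eq]
  have hG : (toConv (i₂.toLinearMap ∘ₗ antipode k) * toConv (i₁.toLinearMap ∘ₗ antipode k)) *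
      toConv (comul (R := k) (A := H)) = 1 := by
    rw [hδ, mul_assoc, ← mul_assoc _ (toConv i₁.toLinearMap), (inv i₁).2, one_mul, (inv i₂).2]
  have := left_inv_eq_right_inv hG (LinearMap.comul_right_inv (R := k) (C := H))
  have := congrArg (fun f : WithConv (H →ₗ[k] H ⊗[k] H) => f x) this
  simp only at this
  rw [(ℛ k x).convMul_apply] at this
  conv_rhs => rw [← (ℛ k x).eq]
  simpa [i₁, i₂] using this.symm

end Antipode

/-! ### Commutation relations in the endomorphism ring of `H*`. -/

section HitEnd

open DualAlgebra

variable (k H : Type*) [CommRing k] [Ring H] [Bialgebra k H]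

/-- The left action of `H` on `H*`, as a homomorphism to the endomorphism ring. -/
def hitEnd : H →ₐ[k] Module.End k (DualAlgebra k H) :=
  AlgHom.ofLinearMap hitLeft (by ext f y; simp) (fun x y => by ext f z; simp [mul_assoc])

variable {k H}

@[simp] theorem hitEnd_apply (x : H) (f : DualAlgebra k H) : hitEnd k H x f = hitLeft x f := rfl

local notation "X" => hitEnd k H
local notation "L" => Algebra.lmul k (DualAlgebra k H)

theorem hitEnd_mul_lmul (x : H) (g : DualAlgebra k H) {κ : Type*} (r : Coalgebra.Repr k x κ) :
    X x * L g = ∑ i ∈ r.index, L (X (r.left i) g) * X (r.right i) := by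
  ext1 f
  have := CoSmash.hitLeft_mul x g f
  rw [← r.eq] at this
  simpa [map_sum] using this

end HitEnd

section HitEndAntipode

open DualAlgebra

variable {k H : Type*} [CommRing k] [Ring H] [HopfAlgebra k H]

local notation "X" => hitEnd k H
local notation "L" => Algebra.lmul k (DualAlgebra k H)
local notation "S" => antipode k (A := H)

-- In the convolution algebra `Hom(H, End H*)`, the relation for `X x * L g` reads `x₁ * K = N *
-- x₁`. Since `xS` is the convolution inverse of `x₁`, multiplying by it on both sides gives `K * xS
-- = xS * N`.
open WithConv in
theorem lmul_mul_hitEnd_antipode (x : H) (g : DualAlgebra k H) {κ : Type*}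
    (r : Coalgebra.Repr k x κ) :
    L g * X (S x) = ∑ i ∈ r.index, X (S (r.left i)) * L (X (r.right i) g) := by
  let x₁ : WithConv (H →ₗ[k] Module.End k (DualAlgebra k H)) := toConv (X).toLinearMap
  let xS : WithConv (H →ₗ[k] Module.End k (DualAlgebra k H)) := toConv ((X).toLinearMap ∘ₗ S)
  let N : WithConv (H →ₗ[k] Module.End k (DualAlgebra k H)) := toConv ((L).toLinearMap ∘ₗ (hitLeft (k := k)).flip g)
  let K : WithConv (H →ₗ[k] Module.End k (DualAlgebra k H)) := toConv ((counit (R := k) (A := H)).smulRight (L g))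
  have h1 : xS * x₁ = 1 := by
    have h2 := LinearMap.algHom_comp_convMul_distrib X (toConv S) (toConv LinearMap.id)
    rw [LinearMap.antipode_mul_id] at h2
    refine WithConv.ofConv_injective (h2.symm.trans ?_)
    ext1 x; simp [LinearMap.convOne_def]
  have h1' : x₁ * xS = 1 := by
    have h2 := LinearMap.algHom_comp_convMul_distrib X (toConv LinearMap.id) (toConv S)
    rw [LinearMap.id_mul_antipode] at h2
    refine WithConv.ofConv_injective (h2.symm.trans ?_)
    ext1 x; simp [LinearMap.convOne_def]
  have h2 : x₁ * K = N * x₁ := by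
    refine WithConv.ofConv_injective (LinearMap.ext fun x => ?_)
    rw [(ℛ k x).convMul_apply, (ℛ k x).convMul_apply]
    refine Eq.trans ?_ (hitEnd_mul_lmul x g (ℛ k x))
    have := congrArg (fun t => X (TensorProduct.rid k H t) * L g) (sum_tmul_counit_eq (ℛ k x))
    simp only [map_sum, TensorProduct.rid_tmul, one_smul, map_smul, Finset.sum_mul] at this
    refine Eq.trans (Finset.sum_congr rfl fun i _ => ?_) this
    simp [x₁, K]
  have h3 : K * xS = xS * N := by
    calc K * xS = xS * x₁ * K * xS := by rw [h1, one_mul]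
      _ = xS * N * (x₁ * xS) := by rw [mul_assoc xS, h2]; simp only [mul_assoc]
      _ = xS * N := by rw [h1', mul_one]
  have h4 := congrArg (fun f : WithConv (H →ₗ[k] Module.End k (DualAlgebra k H)) => f.ofConv x) h3
  change (K * xS) x = (xS * N) x at h4
  rw [r.convMul_apply, r.convMul_apply] at h4
  refine Eq.trans ?_ h4
  have := congrArg (fun t => L g * X (S t)) (Coalgebra.sum_counit_smul r)
  simp only [map_sum, map_smul, Finset.mul_sum] at this
  refine Eq.trans this.symm (Finset.sum_congr rfl fun i _ => ?_)
  simp [xS, K]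

theorem lmul_mul_hitEnd_antipode_antipode (x : H) (g : DualAlgebra k H) {κ : Type*}
    (r : Coalgebra.Repr k x κ) :
    L g * X (S (S x)) =
      ∑ i ∈ r.index, X (S (S (r.right i))) * L (X (S (r.left i)) g) := by
  -- The antipode reverses the comultiplication, hence the exchange of left and right factors.
  let r' : Coalgebra.Repr k (S x) κ :=
    { index := r.index
      left := fun i => S (r.right i)
      right := fun i => S (r.left i)
      eq := by rw [comul_antipode_eq, ← r.eq]; simp [map_sum] }
  exact lmul_mul_hitEnd_antipode (S x) g r'

/-! ### The projection onto the integrals. -/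

variable {ι : Type*} [Fintype ι] {e : ι → H} {c : ι → DualAlgebra k H}

/-- The projection `f ↦ ∑ i, S²(e i) ⇀ (c i * f)` of `H*` onto its space of integrals. -/
def integralProj (e : ι → H) (c : ι → DualAlgebra k H) : Module.End k (DualAlgebra k H) :=
  ∑ i, X (S (S (e i))) * L (c i)

local notation "P" => integralProj e c

/-- Commuting `X(S x)` past `L(c i)` produces `x₂ ⇀ c i`; moving `x₂` across the canonical element
leaves the factor `S²(x₂) S(x₁) = S(x₁ S(x₂))`, which is a counit. -/
theorem integralProj_mul_hitEnd_antipode (h : IsDualBasis e c) (x : H) :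
    P * X (S x) = counit (R := k) x • P := by
  let r := ℛ k x
  have h1 : ∀ a b : H, ∑ i, X (S (S (e i))) * (X (S a) * L (X b (c i))) =
      ∑ i, X (S (S (e i))) * X (S (a * S b)) * L (c i) := by
    intro a b
    let B : DualAlgebra k H →ₗ[k] H →ₗ[k] Module.End k (DualAlgebra k H) :=
      LinearMap.mk₂ k (fun f y => X (S (S y)) * (X (S a) * L f))
        (fun _ _ _ => by simp [mul_add]) (fun _ _ _ => by simp)
        (fun _ _ _ => by simp [add_mul]) (fun _ _ _ => by simp)
    refine Eq.trans (h.sum_apply_map B (LinearMap.mulRight k b))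
      (Finset.sum_congr rfl fun i _ => ?_)
    change X (S (S (e i * b))) * (X (S a) * L (c i)) = _
    simp only [antipode_mul_antidistrib, map_mul, mul_assoc]
  have h2 : P * X (S x) = ∑ j ∈ r.index, ∑ i, X (S (S (e i))) *
      (X (S (r.left j)) * L (X (r.right j) (c i))) := by
    rw [integralProj, Finset.sum_mul, Finset.sum_comm]
    refine Finset.sum_congr rfl fun i _ => ?_
    rw [mul_assoc, lmul_mul_hitEnd_antipode x (c i) r, Finset.mul_sum]
  rw [h2]
  simp only [h1]
  rw [Finset.sum_comm, integralProj, Finset.smul_sum]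
  refine Finset.sum_congr rfl fun i _ => ?_
  rw [← Finset.sum_mul, ← Finset.mul_sum, ← map_sum, ← map_sum, sum_mul_antipode_eq_smul r]
  simp

/-- Evaluated at `y`, the dual basis contracts the sum to `g(y₁ S(y₂))`. -/
theorem sum_hitEnd_antipode_mul (h : IsDualBasis e c) (g : DualAlgebra k H) :
    ∑ i, X (S (e i)) g * c i = g.form 1 • 1 := by
  ext y
  let r := ℛ k y
  simp only [form_sum, form_mul_repr _ _ r, hitEnd_apply, hitLeft_apply]
  rw [Finset.sum_comm]
  have : ∀ j, ∑ i, g.form (r.left j * S (e i)) * (c i).form (r.right j) =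
      g.form (r.left j * S (r.right j)) := fun j => by
    refine Eq.trans ?_ (h.sum_map (g.form ∘ₗ LinearMap.mulLeft k (r.left j) ∘ₗ S) (r.right j))
    simp [mul_comm]
  simp only [this]
  rw [← map_sum, sum_mul_antipode_eq_smul r]
  simp [form_one, mul_comm]

/-- This says that the image of `P` consists of left integrals of `H*`. Commuting `L g` past `X(S² e
i)` involves `Δ(e i)`, which splits the canonical element in two; one copy is then absorbed by
`sum_hitEnd_antipode_mul`. -/
theorem lmul_mul_integralProj (h : IsDualBasis e c) (g : DualAlgebra k H) :
    L g * P = g.form 1 • P := by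
  let B : DualAlgebra k H →ₗ[k] H ⊗[k] H →ₗ[k] Module.End k (DualAlgebra k H) :=
    LinearMap.flip <| TensorProduct.lift <| LinearMap.mk₂ k
      (fun x y => LinearMap.mulLeft k (X (S (S y))) ∘ₗ (L).toLinearMap ∘ₗ
        LinearMap.mulLeft k (X (S x) g))
      (fun _ _ _ => by ext1; simp [mul_add, add_mul]) (fun _ _ _ => by ext1; simp)
      (fun _ _ _ => by ext1; simp [add_mul]) (fun _ _ _ => by ext1; simp)
  have hB : ∀ f x y, B f (x ⊗ₜ y) = X (S (S y)) * L (X (S x) g * f) := fun _ _ _ => rfl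
  have h1 : L g * P = ∑ i, B (c i) (comul (R := k) (e i)) := by
    rw [integralProj, Finset.mul_sum]
    refine Finset.sum_congr rfl fun i _ => ?_
    let r := ℛ k (e i)
    rw [← r.eq, map_sum, ← mul_assoc, lmul_mul_hitEnd_antipode_antipode _ _ r, Finset.sum_mul]
    refine Finset.sum_congr rfl fun j _ => ?_
    rw [hB, map_mul, mul_assoc]
  rw [h1, h.sum_apply_comul, Finset.sum_comm, integralProj, Finset.smul_sum]
  refine Finset.sum_congr rfl fun j _ => ?_
  simp only [hB, ← mul_assoc]
  rw [← Finset.mul_sum, ← map_sum, ← Finset.sum_mul, sum_hitEnd_antipode_mul h]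
  simp

/-- On integrals each `L(c i)` is the scalar `(c i)(1)`, so `P` acts there as `X(S²(1)) = 1`. -/
theorem integralProj_mul_self (h : IsDualBasis e c) : P * P = P := by
  have : P * P = ∑ i, (c i).form 1 • (X (S (S (e i))) * P) := by
    conv_lhs => enter [1]; rw [integralProj]
    rw [Finset.sum_mul]
    refine Finset.sum_congr rfl fun i _ => ?_
    rw [mul_assoc, lmul_mul_integralProj h, mul_smul_comm]
  rw [this]
  have := h.sum_map (LinearMap.mulRight k P ∘ₗ (X).toLinearMap ∘ₗ S ∘ₗ S) 1
  simpa [antipode_one] using this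

/-- After commuting `L g` past `X(S x)`, the left `P` absorbs `X(S x₁)` as `ε(x₁)` and the right `P`
absorbs `L(x₂ ⇀ g)` as `g(x₂)`. -/
theorem integralProj_mul_lmul_mul (h : IsDualBasis e c) (g : DualAlgebra k H) (x : H) :
    P * L g * X (S x) * P = g.form x • P := by
  let r := ℛ k x
  have h1 : P * L g * X (S x) * P = ∑ j ∈ r.index,
      counit (R := k) (r.left j) • g.form (r.right j) • P := by
    rw [mul_assoc P, lmul_mul_hitEnd_antipode x g r, Finset.mul_sum, Finset.sum_mul]
    refine Finset.sum_congr rfl fun j _ => ?_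
    rw [← mul_assoc, integralProj_mul_hitEnd_antipode h, mul_assoc, lmul_mul_integralProj h,
      mul_smul_comm, smul_mul_assoc, integralProj_mul_self h, smul_comm]
    simp
  rw [h1]
  have := congrArg g.form (Coalgebra.sum_counit_smul r)
  simp only [smul_smul, ← Finset.sum_smul]
  simpa using congrArg (· • P) this

/-- The double sum has coefficients `S(e j) S²(e i) = S(S(e i) e j)` against `c i * c j`. It is
therefore a single sum over `Δ(e i)`, where the antipode identity applies. -/
theorem sum_hitEnd_antipode_mul_integralProj_mul (h : IsDualBasis e c) :
    ∑ i, X (S (e i)) * P * L (c i) = 1 := by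
  let B : DualAlgebra k H →ₗ[k] H ⊗[k] H →ₗ[k] Module.End k (DualAlgebra k H) :=
    LinearMap.flip <| TensorProduct.lift <| LinearMap.mk₂ k
      (fun x y => LinearMap.mulLeft k (X (S (S x * y))) ∘ₗ (L).toLinearMap)
      (fun _ _ _ => by ext1; simp [add_mul]) (fun _ _ _ => by ext1; simp)
      (fun _ _ _ => by ext1; simp [mul_add, add_mul]) (fun _ _ _ => by ext1; simp)
  have hB : ∀ f x y, B f (x ⊗ₜ y) = X (S (S x * y)) * L f := fun _ _ _ => rfl
  have h1 : ∑ i, X (S (e i)) * P * L (c i) = ∑ i, B (c i) (comul (R := k) (e i)) := by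
    rw [h.sum_apply_comul, Finset.sum_comm]
    refine Finset.sum_congr rfl fun j _ => ?_
    rw [integralProj, Finset.mul_sum, Finset.sum_mul]
    refine Finset.sum_congr rfl fun i _ => ?_
    simp only [hB, antipode_mul_antidistrib, map_mul, mul_assoc]
  have h2 : ∀ i, B (c i) (comul (R := k) (e i)) = L (counit (R := k) (e i) • c i) := fun i => by
    let r := ℛ k (e i)
    rw [← r.eq, map_sum]
    simp only [hB]
    rw [← Finset.sum_mul, ← map_sum, ← map_sum, sum_antipode_mul_eq_smul r]
    simp [antipode_one]
  rw [h1]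
  simp only [h2]
  rw [← map_sum, h.sum_counit_smul, map_one]

/-! ### Bijectivity of the antipode. -/

variable (k H) in
/-- The antipode of a finitely generated projective Hopf algebra is bijective. -/
theorem antipode_bijective_of_finite_projective [Module.Finite k H] [Module.Projective k H] :
    Function.Bijective (antipode k (A := H)) := by
  obtain ⟨n, e, c, h⟩ := exists_isDualBasis k H
  let ev : Module.End k (DualAlgebra k H) →ₗ[k] k :=
    { toFun := fun φ => (φ 1).form 1
      map_add' := fun _ _ => rfl
      map_smul' := fun _ _ => rfl }
  -- Replacing `y` by `S x` in `X(S e j) P L(c i) X(y) P L(c j)` yields `(c i)(x) X(S e j) P L(c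
  -- j)`. Summing over `j` gives `(c i)(x)` times the identity, and `ev`, normalised by `ev 1 = 1`,
  -- extracts the coordinate.
  let T : H →ₗ[k] H := ∑ j, ∑ i, LinearMap.toSpanSingleton k H (e i) ∘ₗ ev ∘ₗ
    LinearMap.mulLeft k (X (S (e j)) * integralProj e c * L (c i)) ∘ₗ
    LinearMap.mulRight k (integralProj e c * L (c j)) ∘ₗ (X).toLinearMap
  have hT : ∀ x, T (S x) = x := by
    intro x
    have h1 : ∀ i j, X (S (e j)) * integralProj e c * L (c i) *
        (X (S x) * (integralProj e c * L (c j))) =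
        (c i).form x • (X (S (e j)) * integralProj e c * L (c j)) := fun i j => by
      have := congrArg (fun t => X (S (e j)) * t * L (c j)) (integralProj_mul_lmul_mul h (c i) x)
      simpa [mul_assoc] using this
    have h2 : T (S x) = ∑ j, ∑ i, ev ((c i).form x •
        (X (S (e j)) * integralProj e c * L (c j))) • e i := by
      simp only [← h1]
      simp only [T, LinearMap.sum_apply, LinearMap.comp_apply, LinearMap.mulLeft_apply,
        LinearMap.mulRight_apply, LinearMap.toSpanSingleton_apply, AlgHom.toLinearMap_apply]
    have h3 : ev 1 = 1 := by
      change (1 : DualAlgebra k H).form 1 = 1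
      simp [form_one]
    rw [h2]
    have h4 : ∀ j, ∑ i, ev ((c i).form x • (X (S (e j)) * integralProj e c * L (c j))) • e i =
        ev (X (S (e j)) * integralProj e c * L (c j)) • x := fun j => by
      conv_rhs => rw [← h x]
      rw [Finset.smul_sum]
      refine Finset.sum_congr rfl fun i _ => ?_
      rw [map_smul, smul_eq_mul, mul_comm, mul_smul]
    simp only [h4]
    rw [← Finset.sum_smul, ← map_sum, sum_hitEnd_antipode_mul_integralProj_mul h, h3, one_smul]
  have hTi : Function.Injective T :=
    OrzechProperty.injective_of_surjective_endomorphism T fun x => ⟨S x, hT x⟩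
  exact ⟨Function.LeftInverse.injective hT, fun x => ⟨T x, hTi (hT (T x))⟩⟩

variable (k H) in
/-- The inverse of the antipode satisfies the antipode identities for the opposite
comultiplication. -/
theorem exists_twisted_antipode [Module.Finite k H] [Module.Projective k H] :
    ∃ T : H →ₗ[k] H,
      (∀ x, ∑ i ∈ (ℛ k x).index, T ((ℛ k x).right i) * (ℛ k x).left i = counit (R := k) x • 1) ∧
      ∀ x, ∑ i ∈ (ℛ k x).index, (ℛ k x).right i * T ((ℛ k x).left i) = counit (R := k) x • 1 := by
  have hS := antipode_bijective_of_finite_projective k H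
  let s := LinearEquiv.ofBijective (antipode k (A := H)) hS
  have hs : ∀ x, S (s.symm x) = x := s.apply_symm_apply
  -- Applying the injective anti-homomorphism `S` turns both identities into the usual ones for the
  -- antipode.
  refine ⟨s.symm.toLinearMap, fun x => hS.1 ?_, fun x => hS.1 ?_⟩
  · simp [map_sum, antipode_mul_antidistrib, hs, sum_antipode_mul_eq_smul (ℛ k x), antipode_one]
  · simp [map_sum, antipode_mul_antidistrib, hs, sum_mul_antipode_eq_smul (ℛ k x), antipode_one]

end HitEndAntipode

/-! ### The action of `(A # H*) # H` on `A # H*`. -/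

namespace CoSmash

open DualAlgebra

section Bialgebra

variable {k H A : Type*} [CommRing k] [Ring H] [Bialgebra k H] [Ring A] [Algebra k A]

variable (k H A) in
/-- The map `f ↦ 1 # f`. -/
def inr : DualAlgebra k H →ₗ[k] CoSmash k H A :=
  TensorProduct.mk k A (DualAlgebra k H) 1

theorem inr_apply (f : DualAlgebra k H) : inr k H A f = mk 1 f := rfl

variable [RightComoduleAlgebra k H A]

theorem mk_mul_inr (a : A) (f g : DualAlgebra k H) : mk a f * inr k H A g = mk a (f * g) := by
  have := mk_mul_mk (k := k) (Finset.univ : Finset Unit) (fun _ => (1 : A)) (fun _ => (1 : H))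
    a 1 f g (by simp [Algebra.TensorProduct.one_def])
  have h1 : hitRight f (1 : H) = f := by ext; simp
  simpa [inr_apply, h1] using this

theorem inr_mul_inr (f g : DualAlgebra k H) :
    inr k H A f * inr k H A g = inr k H A (f * g) :=
  mk_mul_inr 1 f g

theorem smul_inr (x : H) (f : DualAlgebra k H) :
    x • inr k H A f = inr k H A (hitLeft x f) := rfl

theorem smul_mul_repr (x : H) (z w : CoSmash k H A) :
    x • (z * w) = ∑ i ∈ (ℛ k x).index, ((ℛ k x).left i • z) * ((ℛ k x).right i • w) := by
  rw [LeftModuleAlgebra.smul_mul_eq (k := k), ← (ℛ k x).eq, map_sum]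
  rfl

theorem smul_mk_one (x : H) (a : A) :
    x • (mk a 1 : CoSmash k H A) = counit (R := k) x • mk a 1 := by
  have : hitLeft x (1 : DualAlgebra k H) = counit (R := k) x • (1 : DualAlgebra k H) := by
    ext y; simp [form_one, mul_comm]
  rw [smul_mk, this]
  exact TensorProduct.tmul_smul _ _ _

/-- The action of `H` on `A # H*` commutes with the right action of `A`. -/
theorem smul_mul_mk_one (x : H) (z : CoSmash k H A) (a : A) :
    x • (z * mk a 1) = x • z * mk a 1 := by
  rw [smul_mul_repr]
  simp only [smul_mk_one, mul_smul_comm, ← smul_mul_assoc, ← Finset.sum_mul, ← smul_assoc]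
  rw [← Finset.sum_smul]
  have := congrArg (TensorProduct.rid k H) (sum_tmul_counit_eq (ℛ k x))
  simp only [map_sum, TensorProduct.rid_tmul, one_smul] at this
  rw [this]

variable (k H A) in
/-- The left action of `H` on `A # H*`, as a homomorphism to the endomorphism ring. -/
def smulEnd : H →ₐ[k] Module.End k (CoSmash k H A) :=
  AlgHom.ofLinearMap
    (LinearMap.mk₂ k (fun x z => x • z) (fun _ _ _ => add_smul _ _ _)
      (fun _ _ _ => smul_assoc _ _ _) (fun _ _ _ => smul_add _ _ _)
      (fun c x z => smul_algebra_smul_comm c x z))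
    (by ext1 z; exact one_smul H z) (fun x y => by ext1 z; exact mul_smul x y z)

variable (k H A) in
/-- The action `(r # x) z = r (x • z)` of `(A # H*) # H` on `A # H*`, as a linear map. -/
def actLinear : CoSmash k H A ⊗[k] H →ₗ[k] Module.End k (CoSmash k H A) :=
  TensorProduct.lift ((LinearMap.mul k (Module.End k (CoSmash k H A))).compl₁₂
    (Algebra.lmul k (CoSmash k H A)).toLinearMap (smulEnd k H A).toLinearMap)

theorem actLinear_tmul (r : CoSmash k H A) (x : H) (z : CoSmash k H A) :
    actLinear k H A (r ⊗ₜ x) z = r * x • z := rfl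

theorem actLinear_mul_mk_one (u : CoSmash k H A ⊗[k] H) (z : CoSmash k H A) (a : A) :
    actLinear k H A u (z * mk a 1) = actLinear k H A u z * mk a 1 := by
  induction u with
  | zero => simp
  | add u v hu hv => simp [hu, hv, add_mul]
  | tmul r x => simp only [actLinear_tmul, smul_mul_mk_one, mul_assoc]

theorem actLinear_mul (u v : Smash k H (CoSmash k H A)) :
    actLinear k H A (u * v : Smash k H (CoSmash k H A)) =
      actLinear k H A u * actLinear k H A v := by
  induction u using TensorProduct.induction_on with
  | zero =>
    rw [map_zero, zero_mul]
    exact (congrArg (actLinear k H A) (zero_mul v)).trans (map_zero _)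
  | add u u' hu hu' =>
    rw [map_add, add_mul, ← hu, ← hu']
    exact (congrArg (actLinear k H A)
      (add_mul (R := Smash k H (CoSmash k H A)) u u' v)).trans (map_add _ _ _)
  | tmul r x =>
    induction v using TensorProduct.induction_on with
    | zero =>
      rw [map_zero, mul_zero]
      exact (congrArg (actLinear k H A)
        (mul_zero (M₀ := Smash k H (CoSmash k H A)) _)).trans (map_zero _)
    | add v v' hv hv' =>
      rw [map_add, mul_add, ← hv, ← hv']
      exact (congrArg (actLinear k H A)
        (mul_add (R := Smash k H (CoSmash k H A)) _ v v')).trans (map_add _ _ _)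
    | tmul s y =>
      have := Smash.mk_mul_mk (k := k) (ℛ k x).index (ℛ k x).left (ℛ k x).right r s x y
        (ℛ k x).eq.symm
      refine (congrArg (actLinear k H A) this).trans ?_
      refine (map_sum (actLinear k H A) _ _).trans ?_
      ext1 z
      rw [LinearMap.sum_apply, Module.End.mul_apply, actLinear_tmul, actLinear_tmul,
        smul_mul_repr, Finset.mul_sum]
      refine Finset.sum_congr rfl fun i _ => ?_
      refine (actLinear_tmul (r * (ℛ k x).left i • s) ((ℛ k x).right i * y) z).trans ?_
      rw [mul_smul, mul_assoc]

variable (k H A) in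
/-- The homomorphism `(A # H*) # H → End((A # H*)_A)`, `r # x ↦ (z ↦ r (x • z))`. -/
def actHom : Smash k H (CoSmash k H A) →+* Module.End Aᵐᵒᵖ (CoSmash k H A) where
  toFun u :=
    { toFun := actLinear k H A u
      map_add' := map_add _
      map_smul' := fun a z => actLinear_mul_mk_one u z a.unop }
  map_one' := LinearMap.ext fun z =>
    (actLinear_tmul (1 : CoSmash k H A) (1 : H) z).trans (by rw [one_smul, one_mul]; rfl)
  map_mul' u v := LinearMap.ext fun z => DFunLike.congr_fun (actLinear_mul u v) z
  map_zero' := LinearMap.ext fun z =>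
    DFunLike.congr_fun (map_zero (actLinear k H A)) z
  map_add' u v := LinearMap.ext fun z =>
    DFunLike.congr_fun (map_add (actLinear k H A) u v) z

end Bialgebra

/-! ### Inverting the action map. -/

section Hopf

variable {k H A : Type*} [CommRing k] [Ring H] [HopfAlgebra k H] [Ring A] [Algebra k A]
  [RightComoduleAlgebra k H A] {T : H →ₗ[k] H}

/-- `a # f = (1 # (f ↼ T(a₁))) (a₀ # ε)` for a twisted antipode `T`, so that the elements `1 # f`
generate `A # H*` as a right `A`-module. -/
theorem span_range_inr
    (hT : ∀ x, ∑ i ∈ (ℛ k x).index, T ((ℛ k x).right i) * (ℛ k x).left i = counit (R := k) x • 1) :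
    Submodule.span Aᵐᵒᵖ (Set.range (inr k H A)) = ⊤ := by
  rw [eq_top_iff]
  intro z _
  have hmk : ∀ (a : A) (f : DualAlgebra k H),
      (mk a f : CoSmash k H A) ∈ Submodule.span Aᵐᵒᵖ (Set.range (inr k H A)) := by
    intro a f
    let Ξ : H ⊗[k] H →ₗ[k] DualAlgebra k H :=
      hitRight f ∘ₗ LinearMap.mul' k H ∘ₗ T.rTensor H ∘ₗ (TensorProduct.comm k H H).toLinearMap
    have hΞ : Ξ ∘ₗ comul = (counit (R := k) (A := H)).smulRight f := by
      ext1 x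
      have h1 : hitRight f (1 : H) = f := by ext; simp
      rw [LinearMap.comp_apply, ← (ℛ k x).eq]
      simp only [Ξ, LinearMap.comp_apply, map_sum, LinearEquiv.coe_coe, TensorProduct.comm_tmul,
        LinearMap.rTensor_tmul, LinearMap.mul'_apply]
      rw [← map_sum, hT, map_smul, h1]
      rfl
    -- For `u = b ⊗ x` the element is `(1 # (f ↼ T(x))) (b # ε)`. For `u` the coaction of `a`,
    -- coassociativity and `hΞ` reduce it to `a # f`.
    have hu : ∀ u : A ⊗[k] H, (Ξ.lTensor A (TensorProduct.assoc k A H H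
        ((RightComoduleAlgebra.coact (k := k) (H := H) (A := A)).toLinearMap.rTensor H u)) :
          CoSmash k H A) ∈ Submodule.span Aᵐᵒᵖ (Set.range (inr k H A)) := by
      intro u
      induction u with
      | zero => simp only [map_zero]; exact Submodule.zero_mem _
      | add u v hu hv => simp only [map_add]; exact Submodule.add_mem _ hu hv
      | tmul b x =>
        have h2 : Ξ.lTensor A (TensorProduct.assoc k A H H
            ((RightComoduleAlgebra.coact (k := k) (H := H) (A := A)).toLinearMap.rTensor H
              (b ⊗ₜ x))) =
            twistedMul (twist (k := k) (H := H) (A := A)) (1 ⊗ₜ hitRight f (T x)) (b ⊗ₜ 1) := by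
          rw [twistedMul_tmul]
          rw [twist_apply, LinearMap.rTensor_tmul, AlgHom.toLinearMap_apply]
          generalize RightComoduleAlgebra.coact (k := k) (H := H) b = v
          induction v with
          | zero => simp
          | add v v' hv hv' => simp only [TensorProduct.add_tmul, map_add, hv, hv']
          | tmul d y =>
            simp only [TensorProduct.assoc_tmul, LinearMap.lTensor_tmul, TensorProduct.map_tmul,
              LinearMap.mulLeft_apply, LinearMap.mulRight_apply, one_mul, mul_one]
            congr 1
            ext w
            simp [Ξ, mul_assoc]
        have h3 : MulOpposite.op b • inr k H A (hitRight f (T x)) ∈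
            Submodule.span Aᵐᵒᵖ (Set.range (inr k H A)) :=
          Submodule.smul_mem _ _ (Submodule.subset_span ⟨_, rfl⟩)
        exact (congrArg (fun t : CoSmash k H A =>
          t ∈ Submodule.span Aᵐᵒᵖ (Set.range (inr k H A))) h2).mpr h3
    have h3 : ∀ u : A ⊗[k] H, ((counit (R := k) (A := H)).smulRight f).lTensor A u =
        TensorProduct.rid k A ((counit (R := k) (A := H)).lTensor A u) ⊗ₜ[k] f := by
      intro u
      induction u with
      | zero => simp
      | add u v hu hv => simp only [map_add, TensorProduct.add_tmul, hu, hv]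
      | tmul b x => simp [TensorProduct.smul_tmul]
    have h4 := hu (RightComoduleAlgebra.coact (k := k) a)
    rw [RightComoduleAlgebra.coassoc, ← LinearMap.comp_apply, ← LinearMap.lTensor_comp, hΞ, h3,
      RightComoduleAlgebra.counit_coact] at h4
    exact h4
  induction z using TensorProduct.induction_on with
  | zero => exact Submodule.zero_mem _
  | add z w hz hw => exact Submodule.add_mem _ (hz trivial) (hw trivial)
  | tmul a f => exact hmk a f

variable {ι : Type*} [Fintype ι] {e : ι → H} {c : ι → DualAlgebra k H}

/-- The inverse `φ ↦ ∑ i j, φ(1 # c j) (1 # c i) # T(e i) e j` of the action map, for a dual basis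
`(e, c)` of `H` and a twisted antipode `T`. -/
def actInv (T : H →ₗ[k] H) (e : ι → H) (c : ι → DualAlgebra k H)
    (φ : CoSmash k H A → CoSmash k H A) : CoSmash k H A ⊗[k] H :=
  ∑ i, ∑ j, (φ (inr k H A (c j)) * inr k H A (c i)) ⊗ₜ[k] (T (e i) * e j)

theorem actInv_add (φ ψ : CoSmash k H A → CoSmash k H A) :
    actInv T e c (φ + ψ) = actInv T e c φ + actInv T e c ψ := by
  simp only [actInv, Pi.add_apply, add_mul, TensorProduct.add_tmul, Finset.sum_add_distrib]

/-- For `r # x` the sum is `∑ r (1 # (x ⇀ c j) c i) # T(e i) e j`. Moving `x` to the right of `e j`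
leaves `c j * c i` against `T(e i) e j`, that is, `c l` against `T(y₂) y₁` with `y = e l`; this is a
counit. -/
theorem actInv_actLinear (h : IsDualBasis e c)
    (hT : ∀ x, ∑ i ∈ (ℛ k x).index, T ((ℛ k x).right i) * (ℛ k x).left i = counit (R := k) x • 1)
    (u : CoSmash k H A ⊗[k] H) : actInv T e c (actLinear k H A u) = u := by
  induction u with
  | zero => simp [actInv]
  | add u v hu hv =>
    rw [map_add]
    exact (actInv_add _ _).trans (congrArg₂ _ hu hv)
  | tmul r x =>
    let B : ι → DualAlgebra k H →ₗ[k] H →ₗ[k] CoSmash k H A ⊗[k] H := fun i =>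
      LinearMap.mk₂ k (fun f y => (r * inr k H A (f * c i)) ⊗ₜ[k] (T (e i) * y))
        (fun _ _ _ => by simp [add_mul, mul_add, TensorProduct.add_tmul])
        (fun _ _ _ => by simp [TensorProduct.smul_tmul'])
        (fun _ _ _ => by simp [mul_add, TensorProduct.tmul_add])
        (fun _ _ _ => by simp)
    let C : DualAlgebra k H →ₗ[k] H ⊗[k] H →ₗ[k] CoSmash k H A ⊗[k] H :=
      LinearMap.flip <| TensorProduct.lift <| LinearMap.mk₂ k
        (fun a b => (TensorProduct.mk k (CoSmash k H A) H).flip (T b * (a * x)) ∘ₗ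
          LinearMap.mulLeft k r ∘ₗ inr k H A)
        (fun _ _ _ => by ext1; simp [add_mul, mul_add])
        (fun _ _ _ => by ext1; simp)
        (fun _ _ _ => by ext1; simp [add_mul])
        (fun _ _ _ => by ext1; simp)
    have hC : ∀ f a b, C f (a ⊗ₜ b) = (r * inr k H A f) ⊗ₜ[k] (T b * (a * x)) :=
      fun _ _ _ => rfl
    have h1 : actInv T e c (actLinear k H A (r ⊗ₜ x)) =
        ∑ i, C (c i) (comul (R := k) (e i)) := by
      rw [h.sum_apply_comul, Finset.sum_comm, actInv]
      refine Finset.sum_congr rfl fun i _ => ?_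
      refine Eq.trans ?_ (h.sum_apply_map (B i) (LinearMap.mulRight k x))
      refine Finset.sum_congr rfl fun j _ => ?_
      rw [actLinear_tmul, smul_inr, mul_assoc, inr_mul_inr]
      rfl
    have h2 : ∀ i, C (c i) (comul (R := k) (e i)) =
        (r * inr k H A (counit (R := k) (e i) • c i)) ⊗ₜ[k] x := fun i => by
      rw [← (ℛ k (e i)).eq, map_sum]
      simp only [hC, ← mul_assoc]
      rw [← TensorProduct.tmul_sum, ← Finset.sum_mul, hT]
      simp [TensorProduct.smul_tmul']
    rw [h1]
    simp only [h2]
    rw [← TensorProduct.sum_tmul, ← Finset.mul_sum, ← map_sum, h.sum_counit_smul]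
    exact congrArg (· ⊗ₜ[k] x) (mul_one r)

/-- Evaluated at `y`, the dual basis contracts the sum to `g(y₂ T(y₁))`. -/
theorem sum_mul_hitLeft_twisted (h : IsDualBasis e c)
    (hT : ∀ x, ∑ i ∈ (ℛ k x).index, (ℛ k x).right i * T ((ℛ k x).left i) = counit (R := k) x • 1)
    (g : DualAlgebra k H) : ∑ i, c i * hitLeft (T (e i)) g = g.form 1 • 1 := by
  ext y
  let r := ℛ k y
  simp only [form_sum, form_mul_repr _ _ r, hitLeft_apply]
  rw [Finset.sum_comm]
  have : ∀ j, ∑ i, (c i).form (r.left j) * g.form (r.right j * T (e i)) =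
      g.form (r.right j * T (r.left j)) := fun j => by
    refine Eq.trans ?_ (h.sum_map (g.form ∘ₗ LinearMap.mulLeft k (r.right j) ∘ₗ T) (r.left j))
    simp
  simp only [this]
  rw [← map_sum, hT]
  simp [form_one, mul_comm]

/-- The sum over `i` collapses to the scalar `(e j ⇀ g)(1) = g(e j)`, and `∑ j, g(e j) c j = g`. -/
theorem actLinear_actInv_inr (h : IsDualBasis e c)
    (hT : ∀ x, ∑ i ∈ (ℛ k x).index, (ℛ k x).right i * T ((ℛ k x).left i) = counit (R := k) x • 1)
    (φ : CoSmash k H A →ₗ[k] CoSmash k H A) (g : DualAlgebra k H) :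
    actLinear k H A (actInv T e c φ) (inr k H A g) = φ (inr k H A g) := by
  have h1 : ∀ j, ∑ i, (φ (inr k H A (c j)) * inr k H A (c i)) *
      (T (e i) * e j) • inr k H A g = g.form (e j) • φ (inr k H A (c j)) := fun j => by
    simp only [mul_assoc, mul_smul, smul_inr, inr_mul_inr]
    rw [← Finset.mul_sum, ← map_sum, sum_mul_hitLeft_twisted h hT, hitLeft_apply, one_mul,
      map_smul, mul_smul_comm]
    exact congrArg _ (mul_one _)
  rw [actInv, Finset.sum_comm]
  simp only [map_sum, LinearMap.sum_apply, actLinear_tmul, h1]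
  simp only [← map_smul, ← map_sum]
  rw [h.sum_apply_smul]
  rfl

variable (k H A) in
theorem actHom_bijective [Module.Finite k H] [Module.Projective k H] :
    Function.Bijective (actHom k H A) := by
  obtain ⟨n, e, c, h⟩ := exists_isDualBasis k H
  obtain ⟨T, hT, hT'⟩ := exists_twisted_antipode k H
  refine ⟨fun u v huv => ?_, fun φ => ?_⟩
  · have : (actLinear k H A u : CoSmash k H A → CoSmash k H A) = actLinear k H A v :=
      funext fun z => DFunLike.congr_fun huv z
    rw [← actInv_actLinear h hT u, this, actInv_actLinear h hT v]
  -- Right `A`-linearity implies `k`-linearity, since scalars act through `k → A`.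
  · let φ' : CoSmash k H A →ₗ[k] CoSmash k H A :=
      { toFun := φ
        map_add' := map_add φ
        map_smul' := fun t z => by
          have h1 : ∀ w : CoSmash k H A, t • w = MulOpposite.op (algebraMap k A t) • w := by
            intro w
            have h2 : (mk (algebraMap k A t) 1 : CoSmash k H A) = t • 1 := by
              rw [Algebra.algebraMap_eq_smul_one]; rfl
            rw [op_smul_eq, h2, mul_smul_comm, mul_one]
          simp [h1] }
    refine ⟨actInv T e c φ', LinearMap.ext_on_range (span_range_inr hT) fun g => ?_⟩
    exact actLinear_actInv_inr h hT' φ' g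

end Hopf

end CoSmash

end

theorem corollary1p3 {k H A : Type*} [CommRing k]
    [Ring H] [HopfAlgebra k H] [Module.Finite k H] [Module.Projective k H]
    [Ring A] [Algebra k A] [RightComoduleAlgebra k H A] :
    Nonempty (Smash k H (CoSmash k H A) ≃+* Module.End Aᵐᵒᵖ (CoSmash k H A)) :=
  ⟨RingEquiv.ofBijective (CoSmash.actHom k H A) (CoSmash.actHom_bijective k H A)⟩
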